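/- Let $G$ be a finite group, let $\widetilde\Gamma(G)$ be the set of its irreducible complex characters, and let $\langle\theta\mid\varphi\rangle=\frac1{|G|}\sum_{g\in G}\theta(g)\overline{\varphi(g)}$. The weighted character quasigroup of $G$ is $(\widetilde\Gamma(G),w,\alpha)$ with $w(\theta)=\theta(1)^2$ and $\alpha(\theta,\varphi,\psi)=\theta(1)\varphi(1)\psi(1)\langle\theta\varphi\mid\psi\rangle$. A finite quasigroup $Q$ is a character quasigroup of $G$ if there is a surjection (a covering) $f\colon Q\to\widetilde\Gamma(G)$ such that $|f^{-1}\{\theta\}|=w(\theta)$ and $$|\{(p,q)\in f^{-1}\{\theta\}\times f^{-1}\{\varphi\}: f(pq)=\psi\}|=\alpha(\theta,\varphi,\psi)$$ for all $\theta,\varphi,\psi\in\widetilde\Gamma(G)$; it is a character group of $G$ if, moreover, $Q$ is a group. It is a balanced cover of $G$ if $f$ can be chosen such that, in addition, for all $\theta,\varphi$ the number of pairs $(p,q)\in f^{-1}\{\theta\}\times f^{-1}\{\varphi\}$ with $pq=u$ depends on $u\in Q$ only through $f(u)$. Let $n,m\ge 1$. (1) Let $\tau,\sigma\colon\mathbb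 Z/m\to\mathrm{Aut}(\mathbb Z/n)$ be homomorphisms such that $\sigma(1)=\tau(1)^b$ for some integer $b$ (that is, if $\tau(1)$ is multiplication by $k$, then $\sigma(1)$ is multiplication by $k^b$). Then the group $\mathbb Z/n\rtimes_\sigma\mathbb Z/m$ is a balanced cover of $\mathbb Z/n\rtimes_\tau\mathbb Z/m$. (2) In particular, for every homomorphism $\sigma\colon\mathbb Z/m\to\mathrm{Aut}(\mathbb Z/n)$, the group $\mathbb Z/n\rtimes_\sigma\mathbb Z/m$ is a balanced cover of itself. (3) Consequently, every finite split metacyclic group (a finite group that has a cyclic normal subgroup with a cyclic complement) has a character group. -/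

import Mathlib

/-- A set with a multiplication is a quasigroup if all the equations `a * x = b` and `y * a = b`
have unique solutions. -/
def IsQuasigroup (Q : Type*) [Mul Q] : Prop :=
  ∀ a b : Q, (∃! x : Q, a * x = b) ∧ (∃! y : Q, y * a = b)

/-- A weighted quasigroup `(X, w, α)`; here `α x y z` is the multiplicity of `z` in the product of
`x` and `y`, often written `α_z(x, y)`. -/
structure WeightedQuasigroup (X : Type*) where
  w : X → ℕ
  α : X → X → X → ℕ
  sum_product : ∀ x y : X, HasSum (fun z => α x y z) (w x * w y)
  sum_left : ∀ x y : X, HasSum (fun z => α z y x) (w x * w y)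
  sum_right : ∀ x y : X, HasSum (fun z => α x z y) (w x * w y)

/-- `f : Q → X` is a covering of the weighted quasigroup `(X, w, α)` by the finite
quasigroup `Q`. -/
structure IsCovering {X Q : Type*} [Mul Q] (W : WeightedQuasigroup X) (f : Q → X) : Prop where
  finite : Finite Q
  quasigroup : IsQuasigroup Q
  surjective : Function.Surjective f
  weight_eq : ∀ x : X, W.w x = Nat.card {q : Q // f q = x}
  mult_eq : ∀ x y z : X,
    W.α x y z = Nat.card {p : Q × Q // f p.1 = x ∧ f p.2 = y ∧ f (p.1 * p.2) = z}

/-- With `S x = f ⁻¹' {x}`, the number `m_q(S x, S y)`: the multiplicity of `q` in the product of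
the multisets `S x` and `S y`. -/
noncomputable def fiberMultiplicity {X Q : Type*} [Mul Q] (f : Q → X) (x y : X) (q : Q) : ℕ :=
  Nat.card {p : Q × Q // f p.1 = x ∧ f p.2 = y ∧ p.1 * p.2 = q}

/-- A covering is balanced if `m_q(S x, S y)` does not depend on the choice of `q ∈ S z`, for all
`x, y, z`. -/
structure IsBalancedCovering {X Q : Type*} [Mul Q] (W : WeightedQuasigroup X) (f : Q → X) :
    Prop extends IsCovering W f where
  balanced : ∀ x y z : X, ∀ q q' : Q, f q = z → f q' = z →
    fiberMultiplicity f x y q = fiberMultiplicity f x y q'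

/-- The set of irreducible complex characters of a (finite) group. -/
def irreducibleCharacters (G : Type*) [Group G] : Set (G → ℂ) :=
  {χ | ∃ (d : ℕ) (ρ : Representation ℂ G (Fin d → ℂ)), ρ.IsIrreducible ∧ χ = ρ.character}

/-- The scalar product `(1 / |G|) ∑ g, θ g * conj (φ g)` on complex functions on a finite group. -/
noncomputable def charInner {G : Type*} [Group G] (θ φ : G → ℂ) : ℂ :=
  (Nat.card G : ℂ)⁻¹ * ∑ᶠ g : G, θ g * (starRingEnd ℂ) (φ g)

/-- `W` is the weighted character quasigroup of the finite group `G`: its elements are the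
irreducible characters, `w θ = θ(1)²` and `α(θ, φ, ψ) = θ(1) φ(1) ψ(1) ⟨θ φ | ψ⟩`. These two
equations determine `W` uniquely. -/
structure IsWeightedCharacterQuasigroup (G : Type*) [Group G]
    (W : WeightedQuasigroup (irreducibleCharacters G)) : Prop where
  weight_eq : ∀ θ : irreducibleCharacters G, (W.w θ : ℂ) = θ.1 1 ^ 2
  mult_eq : ∀ θ φ ψ : irreducibleCharacters G,
    (W.α θ φ ψ : ℂ) = θ.1 1 * φ.1 1 * ψ.1 1 * charInner (θ.1 * φ.1) ψ.1

/-- `Q` is a character quasigroup of `G`: a quasigroup that covers the weighted character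
quasigroup of `G`. -/
def IsCharacterQuasigroup (Q G : Type*) [Mul Q] [Group G] : Prop :=
  ∃ W : WeightedQuasigroup (irreducibleCharacters G), IsWeightedCharacterQuasigroup G W ∧
    ∃ f : Q → irreducibleCharacters G, IsCovering W f

/-- `Q` is a balanced cover of `G`: it is a character quasigroup of `G` by means of a balanced
covering. -/
def IsBalancedCover (Q G : Type*) [Mul Q] [Group G] : Prop :=
  ∃ W : WeightedQuasigroup (irreducibleCharacters G), IsWeightedCharacterQuasigroup G W ∧
    ∃ f : Q → irreducibleCharacters G, IsBalancedCovering W f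

/-- `G` has a character group: a character quasigroup that is a group. -/
def HasCharacterGroup (G : Type*) [Group G] : Prop :=
  ∃ (Q : Type) (_ : Group Q), IsCharacterQuasigroup Q G

/-- `G` is split metacyclic: it has a cyclic normal subgroup with a cyclic complement, i.e. it is
an internal semidirect product of two cyclic groups. -/
def IsSplitMetacyclic (G : Type*) [Group G] : Prop :=
  ∃ N K : Subgroup G, N.Normal ∧ IsCyclic N ∧ IsCyclic K ∧ N.IsComplement' K

/-- The cyclic group `ℤ/n`, written multiplicatively. -/
abbrev Cyc (n : ℕ) : Type := Multiplicative (ZMod n)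

/-- The generator `1` of `ℤ/n`. -/
abbrev Cyc.gen (n : ℕ) : Cyc n := Multiplicative.ofAdd 1

/-! Let `u` give the multipliers by which ℤ/m acts on ℤ/n through τ. By the little-group method the
irreducible characters of ℤ/n ⋊ ℤ/m are indexed by pairs `(c, j)` in ℤ/n × ℤ/m: `metaChar u (c, j)`
is induced from ℤ/n ⋊ Stab(c). Two pairs give the same character iff the first entries share an
orbit O and the second entries define the same character of the stabilizer S. The covering sends the
element of the other semidirect product with coordinates `(c, j)` to this character. Its fibre is O
times a class of size m/|S| = |O|, so it has |O|² elements, the square of the degree.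

Multiplication by values of `u` preserves orbits, and σ acts by such values. So the substitution y ↦
u(v i) y removes the action from (x, i)(y, k) = (x + u(v i) y, i + k), and pairs in two fibres are
counted as in the direct product (`card_pairs_sameParameters`): solutions in orbits of ℤ/n times
solutions in classes of ℤ/m. Fourier analysis evaluates the second factor
(`card_agreeOn_add_mul_card`); the scalar product of characters splits in the same way
(`sum_metaChar_mul_metaChar_mul_conj`), and the two agree. Balance follows from scaling by `u` in
ℤ/n and from `card_agreeOn_add_eq` in ℤ/m. -/

section SplitMetacyclic

open Finset
open scoped Classical

set_option linter.unusedSectionVars false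

/-- The standard additive character of `ℤ/N`. -/
noncomputable abbrev stdChar (N : ℕ) [NeZero N] : AddChar (ZMod N) ℂ := ZMod.stdAddChar

theorem sum_stdChar_mul {N : ℕ} [NeZero N] (b : ZMod N) :
    ∑ x : ZMod N, stdChar N (x * b) = if b = 0 then (N : ℂ) else 0 := by
  rw [AddChar.sum_mulShift b (ZMod.isPrimitive_stdAddChar N)]
  split_ifs <;> simp [ZMod.card]

theorem conj_stdChar {N : ℕ} [NeZero N] (x : ZMod N) :
    (starRingEnd ℂ) (stdChar N x) = stdChar N (-x) :=
  (AddChar.map_neg_eq_conj _ _).symm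

theorem stdChar_ne_zero {N : ℕ} [NeZero N] (x : ZMod N) : stdChar N x ≠ 0 :=
  Circle.coe_ne_zero _

/-! ### Fourier analysis on ℤ/m. -/

section Fourier

variable {m : ℕ} [NeZero m]

/-- The Fourier transform of `A` at `j`. -/
noncomputable def fourierSum (A : ZMod m → ℂ) (j : ZMod m) : ℂ := ∑ t, A t * stdChar m (j * t)

/-- The convolution theorem; the shift by `k` allows it to be applied twice in succession. -/
theorem sum_fourierSum_mul_fourierSum (A C : ZMod m → ℂ) (j k : ZMod m) :
    ∑ i, fourierSum A (j - i) * fourierSum C (i + k) =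
      m * fourierSum (fun t => A t * C t) (j + k) := by
  simp only [fourierSum, sum_mul_sum]
  rw [sum_comm]
  have h : ∀ t s : ZMod m, ∑ i, A t * stdChar m ((j - i) * t) * (C s * stdChar m ((i + k) * s)) =
      if s = t then A t * C t * stdChar m ((j + k) * t) * m else 0 := by
    intro t s
    have h1 : ∀ i, A t * stdChar m ((j - i) * t) * (C s * stdChar m ((i + k) * s)) =
        A t * C s * stdChar m (j * t + k * s) * stdChar m (i * (s - t)) := by
      intro i
      have : stdChar m ((j - i) * t) * stdChar m ((i + k) * s) =
          stdChar m (j * t + k * s) * stdChar m (i * (s - t)) := by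
        rw [← AddChar.map_add_eq_mul, ← AddChar.map_add_eq_mul]; congr 1; ring
      linear_combination A t * C s * this
    simp only [h1, ← mul_sum, sum_stdChar_mul, sub_eq_zero]
    split_ifs with hst
    · subst hst; rw [add_mul]
    · simp
  have h' : ∀ t, ∑ i, ∑ s, A t * stdChar m ((j - i) * t) * (C s * stdChar m ((i + k) * s)) =
      A t * C t * stdChar m ((j + k) * t) * m := by
    intro t; rw [sum_comm]; simp [h]
  simp only [h', ← sum_mul]; ring

/-- The indicator function of a subgroup. -/
noncomputable def subgroupIndicator (S : AddSubgroup (ZMod m)) (t : ZMod m) : ℂ :=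
  if t ∈ S then 1 else 0

/-- The characters `t ↦ stdChar m (j * t)` and `t ↦ stdChar m (j' * t)` agree on `S`. -/
def AgreeOn (S : AddSubgroup (ZMod m)) (j j' : ZMod m) : Prop :=
  ∀ t ∈ S, stdChar m (j * t) = stdChar m (j' * t)

theorem agreeOn_comm {S : AddSubgroup (ZMod m)} {j j' : ZMod m} :
    AgreeOn S j j' ↔ AgreeOn S j' j :=
  ⟨fun h t ht => (h t ht).symm, fun h t ht => (h t ht).symm⟩

theorem agreeOn_top {j j' : ZMod m} : AgreeOn ⊤ j j' ↔ j = j' := by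
  refine ⟨fun h => ?_, fun h t _ => by rw [h]⟩
  have := h 1 trivial
  simp only [mul_one] at this
  exact ZMod.injective_stdAddChar this

theorem fourierSum_subgroupIndicator (S : AddSubgroup (ZMod m)) (j j' : ZMod m) :
    fourierSum (subgroupIndicator S) (j - j') = if AgreeOn S j j' then (Nat.card S : ℂ) else 0 := by
  have hsplit : ∀ t, stdChar m ((j - j') * t) * stdChar m (j' * t) = stdChar m (j * t) := fun t => by
    rw [← AddChar.map_add_eq_mul]; congr 1; ring
  have hone : ∀ t, stdChar m ((j - j') * t) = 1 ↔ stdChar m (j * t) = stdChar m (j' * t) := by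
    intro t
    rw [← hsplit t, mul_eq_right₀ (stdChar_ne_zero _)]
  split_ifs with h
  · have : ∀ t, subgroupIndicator S t * stdChar m ((j - j') * t) = if t ∈ S then 1 else 0 := by
      intro t
      unfold subgroupIndicator
      split_ifs with ht
      · rw [(hone t).2 (h t ht), one_mul]
      · simp
    simp only [fourierSum, this]
    rw [sum_boole, Nat.card_eq_fintype_card, Fintype.card_subtype]
  · unfold AgreeOn at h
    push Not at h
    obtain ⟨t₀, ht₀, h⟩ := h
    -- Translation by `t₀` permutes `S` and multiplies the sum by a value different from 1.
    refine eq_zero_of_mul_eq_self_left (mt (hone t₀).1 h) ?_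
    rw [fourierSum, mul_sum]
    refine Fintype.sum_equiv (Equiv.addLeft t₀) _ _ fun t => ?_
    simp only [Equiv.coe_addLeft, subgroupIndicator, S.add_mem_cancel_left ht₀, mul_add,
      AddChar.map_add_eq_mul]
    ring

theorem ite_agreeOn_mul_card (S : AddSubgroup (ZMod m)) (j j' : ZMod m) :
    (if AgreeOn S j j' then (1 : ℂ) else 0) * Nat.card S =
      fourierSum (subgroupIndicator S) (j - j') := by
  rw [fourierSum_subgroupIndicator]; split_ifs <;> simp

/-- The number of elements of `ℤ/m` that agree with `j` on `S`. -/
theorem card_agreeOn_mul_card (S : AddSubgroup (ZMod m)) (j : ZMod m) :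
    (Nat.card {i : ZMod m // AgreeOn S i j} : ℂ) * Nat.card S = m := by
  -- The delta function at 0 has constant transform, so convolving with it sums over all `i`.
  have hδ : ∀ i : ZMod m, fourierSum (fun t => if t = 0 then 1 else 0) i = 1 := by
    intro i; simp [fourierSum]
  have h := sum_fourierSum_mul_fourierSum (subgroupIndicator S) (fun t => if t = 0 then 1 else 0) j 0
  simp only [hδ, mul_one, ← ite_agreeOn_mul_card] at h
  rw [← sum_mul, sum_boole] at h
  rw [Nat.card_eq_fintype_card, Fintype.card_subtype]
  simp only [agreeOn_comm (j' := j)]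
  rw [h]
  simp [fourierSum, subgroupIndicator]

/-- The number of pairs with prescribed restrictions of the entries and of their sum. -/
theorem card_agreeOn_add_mul_card (S S' S'' : AddSubgroup (ZMod m)) (j j' j'' : ZMod m) :
    (Nat.card {i : ZMod m × ZMod m //
        AgreeOn S i.1 j ∧ AgreeOn S' i.2 j' ∧ AgreeOn S'' (i.1 + i.2) j''} : ℂ) *
      (Nat.card S * Nat.card S' * Nat.card S'') =
    m ^ 2 * fourierSum (fun t => subgroupIndicator S t * subgroupIndicator S' t *
      subgroupIndicator S'' t) (j + j' - j'') := by
  have h1 : ∀ i : ZMod m × ZMod m,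
      (if AgreeOn S i.1 j ∧ AgreeOn S' i.2 j' ∧ AgreeOn S'' (i.1 + i.2) j'' then (1 : ℂ) else 0) *
        (Nat.card S * Nat.card S' * Nat.card S'') =
      fourierSum (subgroupIndicator S') (j' - i.2) * (fourierSum (subgroupIndicator S) (j - i.1) *
        fourierSum (subgroupIndicator S'') (i.1 + (i.2 - j''))) := by
    intro i
    rw [← add_sub_assoc]
    simp only [← ite_agreeOn_mul_card, agreeOn_comm (j := j),
      agreeOn_comm (j := j')]
    by_cases a : AgreeOn S i.1 j <;> by_cases b : AgreeOn S' i.2 j' <;>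
      by_cases c : AgreeOn S'' (i.1 + i.2) j'' <;> simp [a, b, c]
    ring
  rw [Nat.card_eq_fintype_card, Fintype.card_subtype, ← sum_boole, sum_mul]
  simp only [h1]
  rw [Fintype.sum_prod_type, sum_comm]
  simp only [← mul_sum, sum_fourierSum_mul_fourierSum]
  have h2 : ∀ x : ZMod m, j + (x - j'') = x + (j - j'') := fun x => by ring
  simp only [h2, mul_left_comm _ (m : ℂ)]
  rw [← mul_sum, sum_fourierSum_mul_fourierSum]
  have h3 : j' + (j - j'') = j + j' - j'' := by ring
  rw [h3, pow_two, mul_assoc]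
  congr 4
  ext t
  ring

end Fourier

/-! ### Orbits and stabilizers of the action on ℤ/n. -/

section Orbits

variable {n m : ℕ} [NeZero n] [NeZero m] (u : AddChar (ZMod m) (ZMod n))

/-- The orbit of `c` under multiplication by the values of `u`. -/
noncomputable def mulOrbit (c : ZMod n) : Finset (ZMod n) := univ.image fun s => u s * c

/-- The stabilizer of `c` under multiplication by the values of `u`. -/
def mulStabilizer (c : ZMod n) : AddSubgroup (ZMod m) where
  carrier := {t | u t * c = c}
  zero_mem' := by simp
  add_mem' := by
    intro s t hs ht
    simp only [Set.mem_ofPred_eq] at *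
    rw [AddChar.map_add_eq_mul, mul_assoc, ht, hs]
  neg_mem' := by
    intro t ht
    simp only [Set.mem_ofPred_eq] at *
    conv_lhs => rw [← ht]
    rw [← mul_assoc, ← AddChar.map_add_eq_mul]
    simp

variable {u}

theorem addChar_neg_mul_cancel (t : ZMod m) (x : ZMod n) : u (-t) * (u t * x) = x := by
  rw [← mul_assoc, ← AddChar.map_add_eq_mul]; simp

theorem addChar_mul_neg_cancel (t : ZMod m) (x : ZMod n) : u t * (u (-t) * x) = x := by
  rw [← mul_assoc, ← AddChar.map_add_eq_mul]; simp

theorem mem_mulStabilizer {c : ZMod n} {t : ZMod m} : t ∈ mulStabilizer u c ↔ u t * c = c := Iff.rfl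

theorem mem_mulOrbit {c x : ZMod n} : x ∈ mulOrbit u c ↔ ∃ s, u s * c = x := by
  simp [mulOrbit]

theorem mem_mulOrbit_self (c : ZMod n) : c ∈ mulOrbit u c := mem_mulOrbit.2 ⟨0, by simp⟩

theorem mul_mem_mulOrbit {c x : ZMod n} (t : ZMod m) : u t * x ∈ mulOrbit u c ↔ x ∈ mulOrbit u c := by
  simp only [mem_mulOrbit]
  constructor
  · rintro ⟨s, hs⟩
    exact ⟨-t + s, by rw [AddChar.map_add_eq_mul, mul_assoc, hs, addChar_neg_mul_cancel]⟩
  · rintro ⟨s, rfl⟩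
    exact ⟨t + s, by rw [AddChar.map_add_eq_mul, mul_assoc]⟩

theorem mulStabilizer_eq_of_mem {c x : ZMod n} (h : x ∈ mulOrbit u c) :
    mulStabilizer u x = mulStabilizer u c := by
  obtain ⟨s, rfl⟩ := mem_mulOrbit.1 h
  ext t
  rw [mem_mulStabilizer, mem_mulStabilizer, mul_left_comm]
  refine ⟨fun h => ?_, fun h => by rw [h]⟩
  rw [← addChar_neg_mul_cancel s (u t * c), h, addChar_neg_mul_cancel]

theorem mulStabilizer_congr {c c' : ZMod n} (h : mulOrbit u c = mulOrbit u c') :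
    mulStabilizer u c = mulStabilizer u c' :=
  mulStabilizer_eq_of_mem (h ▸ mem_mulOrbit_self c)

theorem mem_mulStabilizer_iff {c x : ZMod n} (h : x ∈ mulOrbit u c) {t : ZMod m} :
    u t * x = x ↔ u t * c = c := by
  rw [← mem_mulStabilizer, mulStabilizer_eq_of_mem h, mem_mulStabilizer]

theorem mulOrbit_eq_of_mem {c x : ZMod n} (h : x ∈ mulOrbit u c) : mulOrbit u x = mulOrbit u c := by
  obtain ⟨s, rfl⟩ := mem_mulOrbit.1 h
  ext y
  constructor
  · rintro hy
    obtain ⟨t, rfl⟩ := mem_mulOrbit.1 hy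
    simp [mul_mem_mulOrbit, mem_mulOrbit_self]
  · rintro hy
    obtain ⟨t, rfl⟩ := mem_mulOrbit.1 hy
    refine mem_mulOrbit.2 ⟨t - s, ?_⟩
    rw [← mul_assoc, ← AddChar.map_add_eq_mul, sub_add_cancel]

theorem card_mulStabilizer_mul_sum_mulOrbit (c : ZMod n) (F : ZMod n → ℂ) :
    (Nat.card (mulStabilizer u c) : ℂ) * ∑ x ∈ mulOrbit u c, F x = ∑ s, F (u s * c) := by
  rw [sum_comp F (fun s => u s * c), mul_sum]
  refine sum_congr rfl fun x hx => ?_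
  rw [nsmul_eq_mul]
  congr 2
  obtain ⟨s, rfl⟩ := mem_mulOrbit.1 hx
  rw [Nat.card_eq_fintype_card, Fintype.card_subtype]
  -- The elements sending `c` to `u s * c` form the coset of the stabilizer through `s`.
  refine card_bij (fun t _ => t + s) ?_ (fun _ _ _ _ h => add_right_cancel h) ?_
  · intro t ht
    simp only [mem_filter, mem_univ, true_and, mem_mulStabilizer] at *
    rw [add_comm, AddChar.map_add_eq_mul, mul_assoc, ht]
  · intro t ht
    simp only [mem_filter, mem_univ, true_and, mem_mulStabilizer] at *
    refine ⟨-s + t, ?_, by ring⟩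
    rw [AddChar.map_add_eq_mul, mul_assoc, ht, addChar_neg_mul_cancel]

theorem card_mulStabilizer_mul_card_mulOrbit (c : ZMod n) :
    (Nat.card (mulStabilizer u c) : ℂ) * (mulOrbit u c).card = m := by
  have := card_mulStabilizer_mul_sum_mulOrbit (u := u) c 1
  simpa [ZMod.card] using this

theorem card_mulStabilizer_ne_zero (c : ZMod n) : (Nat.card (mulStabilizer u c) : ℂ) ≠ 0 := by
  simp

end Orbits

/-! ### The induced characters. -/

section Characters

variable {n m : ℕ} [NeZero n] [NeZero m] (u : AddChar (ZMod m) (ZMod n))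

/-- The character of `ℤ/n ⋊ ℤ/m` that is induced by the character of `ℤ/n ⋊ Stab(q.1)` with the
parameters `q.1` and `q.2`. -/
noncomputable def metaChar (q p : ZMod n × ZMod m) : ℂ :=
  subgroupIndicator (mulStabilizer u q.1) p.2 * stdChar m (q.2 * p.2) *
    ∑ x ∈ mulOrbit u q.1, stdChar n (x * p.1)

/-- `q` and `q'` are the parameters of the same character. -/
def SameParameters (q q' : ZMod n × ZMod m) : Prop :=
  mulOrbit u q.1 = mulOrbit u q'.1 ∧ AgreeOn (mulStabilizer u q'.1) q.2 q'.2

variable {u}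

/-- Fourier inversion in the first coordinate: it recovers the parameters from the character. -/
theorem sum_stdChar_mul_metaChar (q : ZMod n × ZMod m) (y : ZMod n) (t : ZMod m) :
    ∑ a, stdChar n (-(y * a)) * metaChar u q (a, t) =
      if y ∈ mulOrbit u q.1 then
        n * (subgroupIndicator (mulStabilizer u q.1) t * stdChar m (q.2 * t)) else 0 := by
  have h : ∀ x, ∑ a, stdChar n (-(y * a)) * stdChar n (x * a) = if x = y then (n : ℂ) else 0 := by
    intro x
    have : ∀ a, stdChar n (-(y * a)) * stdChar n (x * a) = stdChar n (a * (x - y)) := fun a => by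
      rw [← AddChar.map_add_eq_mul]; congr 1; ring
    simp only [this, sum_stdChar_mul, sub_eq_zero]
  simp only [metaChar, mul_left_comm (stdChar n _), mul_sum]
  rw [sum_comm]
  simp only [← mul_sum, h]
  rw [mul_sum, ← mul_sum, sum_ite_eq']
  split_ifs
  · ring
  · simp

theorem metaChar_eq_iff (q q' : ZMod n × ZMod m) :
    metaChar u q = metaChar u q' ↔ SameParameters u q q' := by
  constructor
  · intro h
    have key : ∀ y t, _ := fun y t => (sum_stdChar_mul_metaChar q y t).symm.trans
      ((by rw [h]) : _ = _) |>.trans (sum_stdChar_mul_metaChar q' y t)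
    have hn : (n : ℂ) ≠ 0 := NeZero.ne _
    have horb : mulOrbit u q.1 = mulOrbit u q'.1 := by
      ext y
      -- At t = 0 the coefficient is `n` on the orbit and 0 off it; below, y = `q.1` isolates the
      -- second parameter.
      have := key y 0
      by_cases h1 : y ∈ mulOrbit u q.1 <;> by_cases h2 : y ∈ mulOrbit u q'.1 <;>
        simp only [h1, h2, if_true, if_false] at this ⊢ <;> simp [subgroupIndicator, hn, hn.symm] at this
    refine ⟨horb, fun t ht => ?_⟩
    have := key q.1 t
    rw [if_pos (mem_mulOrbit_self _), if_pos (horb ▸ mem_mulOrbit_self _),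
      mulStabilizer_congr horb] at this
    simpa [subgroupIndicator, ht, hn] using this
  · rintro ⟨h1, h2⟩
    ext p
    unfold metaChar
    rw [h1, mulStabilizer_congr h1]
    congr 1
    unfold subgroupIndicator
    split_ifs with h
    · rw [h2 _ h]
    · simp

theorem metaChar_zero (q : ZMod n × ZMod m) : metaChar u q (0, 0) = (mulOrbit u q.1).card := by
  simp [metaChar, subgroupIndicator]

theorem conj_metaChar (q : ZMod n × ZMod m) (p : ZMod n × ZMod m) :
    (starRingEnd ℂ) (metaChar u q p) =
      subgroupIndicator (mulStabilizer u q.1) p.2 * stdChar m (-(q.2 * p.2)) *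
        ∑ x ∈ mulOrbit u q.1, stdChar n (-(x * p.1)) := by
  simp only [metaChar, map_mul, map_sum, conj_stdChar]
  congr 2
  unfold subgroupIndicator
  split_ifs <;> simp

/-- The sum of the values of a product of two characters and the conjugate of a third one. -/
theorem sum_metaChar_mul_metaChar_mul_conj (q q' q'' : ZMod n × ZMod m) :
    ∑ p, metaChar u q p * metaChar u q' p * (starRingEnd ℂ) (metaChar u q'' p) =
      n * Nat.card {x : ZMod n × ZMod n // x.1 ∈ mulOrbit u q.1 ∧ x.2 ∈ mulOrbit u q'.1 ∧
        x.1 + x.2 ∈ mulOrbit u q''.1} *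
      fourierSum (fun t => subgroupIndicator (mulStabilizer u q.1) t *
        subgroupIndicator (mulStabilizer u q'.1) t * subgroupIndicator (mulStabilizer u q''.1) t)
        (q.2 + q'.2 - q''.2) := by
  have h1 : ∀ a : ZMod n, (∑ x ∈ mulOrbit u q.1, stdChar n (x * a)) *
      (∑ x ∈ mulOrbit u q'.1, stdChar n (x * a)) * (∑ x ∈ mulOrbit u q''.1, stdChar n (-(x * a))) =
      ∑ x ∈ mulOrbit u q.1, ∑ y ∈ mulOrbit u q'.1, ∑ z ∈ mulOrbit u q''.1,
        stdChar n (a * (x + y - z)) := by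
    intro a
    rw [sum_mul_sum, sum_mul]
    refine sum_congr rfl fun x _ => ?_
    rw [sum_mul_sum]
    refine sum_congr rfl fun y _ => sum_congr rfl fun z _ => ?_
    rw [← AddChar.map_add_eq_mul, ← AddChar.map_add_eq_mul]
    congr 1; ring
  -- Each character is a function of `a` times a function of `t`; the sum over `a` detects x + y =
  -- z.
  have h2 : ∑ a : ZMod n, (∑ x ∈ mulOrbit u q.1, stdChar n (x * a)) *
      (∑ x ∈ mulOrbit u q'.1, stdChar n (x * a)) * (∑ x ∈ mulOrbit u q''.1, stdChar n (-(x * a))) =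
      n * Nat.card {x : ZMod n × ZMod n // x.1 ∈ mulOrbit u q.1 ∧ x.2 ∈ mulOrbit u q'.1 ∧
        x.1 + x.2 ∈ mulOrbit u q''.1} := by
    simp only [h1]
    rw [sum_comm]
    have h3 : ∀ x, ∑ a : ZMod n, ∑ y ∈ mulOrbit u q'.1, ∑ z ∈ mulOrbit u q''.1,
        stdChar n (a * (x + y - z)) =
        n * ∑ y ∈ mulOrbit u q'.1, if x + y ∈ mulOrbit u q''.1 then 1 else 0 := by
      intro x
      rw [sum_comm, mul_sum]
      refine sum_congr rfl fun y _ => ?_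
      rw [sum_comm]
      simp [sum_stdChar_mul, sub_eq_zero]
    simp only [h3]
    rw [← mul_sum, Nat.card_eq_fintype_card, Fintype.card_subtype, ← sum_boole,
      Fintype.sum_prod_type]
    congr 1
    simp only [ite_and, sum_ite_mem, univ_inter, sum_ite_irrel, sum_const_zero]
  rw [Fintype.sum_prod_type, sum_comm, fourierSum, mul_sum]
  refine sum_congr rfl fun t _ => ?_
  rw [← h2, sum_mul]
  refine sum_congr rfl fun a _ => ?_
  have h4 : stdChar m ((q.2 + q'.2 - q''.2) * t) =
      stdChar m (q.2 * t) * stdChar m (q'.2 * t) * stdChar m (-(q''.2 * t)) := by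
    rw [← AddChar.map_add_eq_mul, ← AddChar.map_add_eq_mul]
    congr 1; ring
  rw [conj_metaChar, h4, metaChar, metaChar]
  ring

/-- Weighted with the orders of the stabilizers, the characters add up to a multiple of the regular
character. -/
theorem sum_card_mulStabilizer_mul_metaChar (p : ZMod n × ZMod m) :
    ∑ q : ZMod n × ZMod m, Nat.card (mulStabilizer u q.1) * metaChar u q p =
      if p = 0 then (m * (n * m) : ℂ) else 0 := by
  obtain ⟨a, t⟩ := p
  -- The sum over `j` forces t = 0. The weight |Stab(c)| turns the orbit sum into a sum over all
  -- `s`, after which the sum over `c` is again an orthogonality relation.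
  have h1 : ∀ c : ZMod n, ∑ j : ZMod m,
      Nat.card (mulStabilizer u c) * metaChar u (c, j) (a, t) =
      if t = 0 then m * ∑ s, stdChar n (c * (u s * a)) else 0 := by
    intro c
    simp only [metaChar]
    have : ∀ j : ZMod m, (Nat.card (mulStabilizer u c) : ℂ) *
        (subgroupIndicator (mulStabilizer u c) t * stdChar m (j * t) *
          ∑ x ∈ mulOrbit u c, stdChar n (x * a)) =
        (subgroupIndicator (mulStabilizer u c) t * ∑ s, stdChar n (c * (u s * a))) *
          stdChar m (j * t) := by
      intro j
      have h := card_mulStabilizer_mul_sum_mulOrbit (u := u) c (fun x => stdChar n (x * a))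
      simp only [mul_comm _ c] at h
      simp only [← mul_assoc c] at h ⊢
      rw [← h]; ring
    simp only [this]
    rw [← mul_sum, sum_stdChar_mul]
    split_ifs with h
    · subst h; simp [subgroupIndicator, mul_comm]
    · simp
  rw [Fintype.sum_prod_type]
  simp only [h1]
  have hu : ∀ s, u s * a = 0 ↔ a = 0 := by
    intro s
    refine ⟨fun h => ?_, fun h => by rw [h, mul_zero]⟩
    rw [← addChar_neg_mul_cancel (u := u) s a, h, mul_zero]
  by_cases ht : t = 0
  · simp only [ht, if_true]
    rw [← mul_sum, sum_comm]
    simp only [sum_stdChar_mul, hu]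
    by_cases ha : a = 0
    · simp [ha, ZMod.card, mul_comm]
    · simp [ha]
  · simp [ht]

end Characters

/-! ### Orthogonality and a completeness criterion. -/

section Orthogonality

variable {H : Type*} [Group H] [Fintype H]

theorem sum_mul_inv_eq_zero_of_ne {χ χ' : H → ℂ} (hχ : χ ∈ irreducibleCharacters H)
    (hχ' : χ' ∈ irreducibleCharacters H) (h : χ ≠ χ') : ∑ g, χ g * χ' g⁻¹ = 0 := by
  obtain ⟨d, ρ, hρ, rfl⟩ := hχ
  obtain ⟨d', ρ', hρ', rfl⟩ := hχ'
  have hc : (Nat.card H : ℂ) ≠ 0 := by simp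
  let := invertibleOfNonzero hc
  have := Representation.char_orthonormal ρ ρ'
  rw [if_neg] at this
  · simpa [hc] using this
  · rintro ⟨φ⟩
    exact h (Representation.char_iso φ).symm

theorem irreducibleCharacter_one_ne_zero {χ : H → ℂ} (hχ : χ ∈ irreducibleCharacters H) :
    χ 1 ≠ 0 := by
  obtain ⟨d, ρ, hρ, rfl⟩ := hχ
  rw [Representation.char_one, Module.finrank_fin_fun]
  rintro h
  have hd : d = 0 := by exact_mod_cast h
  subst hd
  obtain ⟨W, W', hW⟩ := hρ.toNontrivial
  exact hW (Subrepresentation.toSubmodule_injective (Subsingleton.elim _ _))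

/-- If a combination of irreducible characters with a common index set is supported at `1`, where
it does not vanish, then there are no other irreducible characters. -/
theorem exists_eq_of_sum_eq_ite {ι : Type*} [Fintype ι] (θ : ι → H → ℂ) (a : ι → ℂ) {r : ℂ}
    (hr : r ≠ 0) (hθ : ∀ i, θ i ∈ irreducibleCharacters H)
    (hsum : ∀ h, ∑ i, a i * θ i h = if h = 1 then r else 0)
    {χ : H → ℂ} (hχ : χ ∈ irreducibleCharacters H) : ∃ i, χ = θ i := by
  by_contra! hne
  -- Pairing `χ` with the combination gives 0 by orthogonality, but also `χ 1 * r`.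
  have h1 : ∑ i, a i * ∑ g, χ g * θ i g⁻¹ = 0 :=
    sum_eq_zero fun i _ => by rw [sum_mul_inv_eq_zero_of_ne hχ (hθ i) (hne i), mul_zero]
  simp only [mul_sum, mul_left_comm (a _)] at h1
  rw [sum_comm] at h1
  simp only [← mul_sum, hsum, inv_eq_one] at h1
  simp [hr, irreducibleCharacter_one_ne_zero hχ] at h1

end Orthogonality

/-! ### Realization on functions on an orbit, and irreducibility. -/

section Representation

variable {n m : ℕ} [NeZero n] [NeZero m] {u : AddChar (ZMod m) (ZMod n)}

/-- Multiplication by `u t` on an orbit. -/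
def mulOrbitMap (c : ZMod n) (t : ZMod m) (x : mulOrbit u c) : mulOrbit u c :=
  ⟨u t * x, (mul_mem_mulOrbit t).2 x.2⟩

variable {H : Type*} [Group H] {e : H ≃ ZMod n × ZMod m}

theorem coordinates_one
    (he : ∀ g h, e (g * h) = ((e g).1 + u (e g).2 * (e h).1, (e g).2 + (e h).2)) : e 1 = (0, 0) := by
  have h := he 1 1
  rw [mul_one, Prod.ext_iff] at h
  have h2 : (e 1).2 = 0 := by simpa using h.2
  have h1 := h.1
  rw [h2] at h1
  exact Prod.ext (by simpa using h1) h2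

/-- The representation of `ℤ/n ⋊ ℤ/m` on the functions on an orbit. -/
noncomputable def metaRepresentation
    (he : ∀ g h, e (g * h) = ((e g).1 + u (e g).2 * (e h).1, (e g).2 + (e h).2))
    (q : ZMod n × ZMod m) {ι : Type*} (ε : ι ≃ mulOrbit u q.1) : Representation ℂ H (ι → ℂ) where
  toFun h :=
    { toFun := fun F i => stdChar m (q.2 * (e h).2) * stdChar n (ε i * (e h).1) *
        F (ε.symm (mulOrbitMap q.1 (e h).2 (ε i)))
      map_add' := fun F F' => by ext i; simp only [Pi.add_apply]; ring
      map_smul' := fun r F => by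
        ext i; simp only [Pi.smul_apply, smul_eq_mul, RingHom.id_apply]; ring }
  map_one' := by
    ext F i
    simp [coordinates_one he, mulOrbitMap]
  map_mul' g h := by
    refine LinearMap.ext fun F => funext fun i => ?_
    have h1 : mulOrbitMap q.1 ((e g).2 + (e h).2) (ε i) =
        mulOrbitMap q.1 (e h).2 (mulOrbitMap q.1 (e g).2 (ε i)) := by
      ext
      simp only [mulOrbitMap, AddChar.map_add_eq_mul]
      ring
    have h2 : ((mulOrbitMap q.1 (e g).2 (ε i) : mulOrbit u q.1) : ZMod n) =
      u (e g).2 * ε i := rfl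
    simp only [LinearMap.coe_mk, AddHom.coe_mk, Module.End.mul_apply, he, h1,
      Equiv.apply_symm_apply, mul_add, AddChar.map_add_eq_mul, h2]
    rw [show u (e g).2 * (ε i : ZMod n) * (e h).1 = ε i * (u (e g).2 * (e h).1) by ring]
    ring

variable (he : ∀ g h, e (g * h) = ((e g).1 + u (e g).2 * (e h).1, (e g).2 + (e h).2))
  (q : ZMod n × ZMod m) {ι : Type*} (ε : ι ≃ mulOrbit u q.1)

theorem metaRepresentation_apply (h : H) (F : ι → ℂ) (i : ι) :
    metaRepresentation he q ε h F i = stdChar m (q.2 * (e h).2) * stdChar n (ε i * (e h).1) *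
      F (ε.symm (mulOrbitMap q.1 (e h).2 (ε i))) := rfl

/-- The operators are monomial, and all points of an orbit have the same stabilizer, so the diagonal
is zero unless `(e h).2` lies in it. -/
theorem character_metaRepresentation [Fintype ι] (h : H) :
    (metaRepresentation he q ε).character h = metaChar u q (e h) := by
  rw [Representation.character, LinearMap.trace_eq_matrix_trace ℂ (Pi.basisFun ℂ ι), Matrix.trace]
  have h1 : ∀ i, ε.symm (mulOrbitMap q.1 (e h).2 (ε i)) = i ↔
      (e h).2 ∈ mulStabilizer u q.1 := by
    intro i
    rw [Equiv.symm_apply_eq, Subtype.ext_iff, mem_mulStabilizer, ← mem_mulStabilizer_iff (ε i).2]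
    rfl
  simp only [Matrix.diag_apply, LinearMap.toMatrix_apply, Pi.basisFun_apply, Pi.basisFun_repr,
    metaRepresentation_apply, Pi.single_apply, h1]
  rw [metaChar, subgroupIndicator, ← sum_coe_sort (mulOrbit u q.1), mul_sum, ← Equiv.sum_comp ε]
  refine sum_congr rfl fun i _ => ?_
  ring

/-- The delta functions are weight vectors of ℤ/n with distinct weights. Projection to a weight puts
one of them into any nonzero subrepresentation, and transitivity on the orbit supplies the rest. -/
theorem isIrreducible_metaRepresentation [Fintype ι] : (metaRepresentation he q ε).IsIrreducible := by
  let i₀ : ι := ε.symm ⟨q.1, mem_mulOrbit_self _⟩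
  have key : ∀ W : Subrepresentation (metaRepresentation he q ε),
      (∃ F ∈ W.toSubmodule, F ≠ 0) → W.toSubmodule = ⊤ := by
    rintro W ⟨F, hF, hF0⟩
    obtain ⟨i, hi⟩ := Function.ne_iff.1 hF0
    have hn : (n : ℂ) ≠ 0 := NeZero.ne _
    have hsingle : Pi.single i (1 : ℂ) ∈ W.toSubmodule := by
      have hmem : ∑ a : ZMod n, stdChar n (-(ε i * a)) •
          metaRepresentation he q ε (e.symm (a, 0)) F ∈ W.toSubmodule :=
        Submodule.sum_mem _ fun a _ => Submodule.smul_mem _ _ (W.apply_mem_toSubmodule _ hF)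
      have heq : ∑ a : ZMod n, stdChar n (-(ε i * a)) •
          metaRepresentation he q ε (e.symm (a, 0)) F = (n * F i) • Pi.single i (1 : ℂ) := by
        ext k
        have h1 : ∀ a : ZMod n, stdChar n (-(ε i * a)) *
            (metaRepresentation he q ε (e.symm (a, 0)) F k) =
            stdChar n (a * (ε k - ε i)) * F k := by
          intro a
          have h2 : mulOrbitMap q.1 (0 : ZMod m) (ε k) = ε k := by ext; simp [mulOrbitMap]
          rw [metaRepresentation_apply]
          simp only [Equiv.apply_symm_apply, mul_zero, AddChar.map_zero_eq_one, one_mul, h2,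
            Equiv.symm_apply_apply]
          rw [← mul_assoc, ← AddChar.map_add_eq_mul]
          congr 2; ring
        simp only [Finset.sum_apply, Pi.smul_apply, smul_eq_mul, h1]
        rw [← sum_mul, sum_stdChar_mul]
        simp only [sub_eq_zero, ← Subtype.ext_iff, EmbeddingLike.apply_eq_iff_eq, Pi.single_apply]
        split_ifs with hk
        · rw [hk]; ring
        · simp
      rw [heq] at hmem
      exact (Submodule.smul_mem_iff _ (mul_ne_zero hn hi)).1 hmem
    have hall : ∀ k, Pi.single k (1 : ℂ) ∈ W.toSubmodule := by
      intro k
      obtain ⟨s, hs⟩ : ∃ s, u s * (ε k : ZMod n) = ε i :=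
        mem_mulOrbit.1 (by rw [mulOrbit_eq_of_mem (ε k).2]; exact (ε i).2)
      have hmem := W.apply_mem_toSubmodule (e.symm (0, s)) hsingle
      have heq : metaRepresentation he q ε (e.symm (0, s)) (Pi.single i 1) =
          stdChar m (q.2 * s) • Pi.single k (1 : ℂ) := by
        ext l
        rw [metaRepresentation_apply]
        have h3 : ε.symm (mulOrbitMap q.1 s (ε l)) = i ↔ l = k := by
          rw [Equiv.symm_apply_eq, Subtype.ext_iff, ← hs]
          change u s * (ε l : ZMod n) = _ ↔ _
          refine ⟨fun h => ε.injective (Subtype.ext ?_), fun h => by rw [h]⟩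
          rw [← addChar_neg_mul_cancel (u := u) s (ε l), h, addChar_neg_mul_cancel]
        simp [Pi.single_apply, h3]
      rw [heq] at hmem
      exact (Submodule.smul_mem_iff _ (stdChar_ne_zero _)).1 hmem
    rw [eq_top_iff]
    rintro F' -
    rw [pi_eq_sum_univ F']
    refine Submodule.sum_mem _ fun k _ => Submodule.smul_mem _ _ ?_
    convert hall k using 1
    ext l
    simp [Pi.single_apply, eq_comm]
  refine { exists_pair_ne := ⟨⊥, ⊤, ?_⟩, eq_bot_or_eq_top := fun W => ?_ }
  · intro h
    have : (Pi.single i₀ 1 : ι → ℂ) ∈ (⊥ : Subrepresentation (metaRepresentation he q ε)) := by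
      rw [h]; trivial
    have h0 : (Pi.single i₀ 1 : ι → ℂ) = 0 := (Submodule.mem_bot ℂ).1 this
    simpa using congrFun h0 i₀
  · by_cases h : ∃ F ∈ W.toSubmodule, F ≠ 0
    · exact Or.inr (Subrepresentation.toSubmodule_injective (key W h))
    · left
      push Not at h
      refine Subrepresentation.toSubmodule_injective ((Submodule.eq_bot_iff _).2 h)

end Representation

/-! ### All irreducible characters are of this form. -/

section Classification

variable {n m : ℕ} [NeZero n] [NeZero m] {u : AddChar (ZMod m) (ZMod n)}
  {H : Type*} [Group H] {e : H ≃ ZMod n × ZMod m}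

theorem metaChar_mem_irreducibleCharacters
    (he : ∀ g h, e (g * h) = ((e g).1 + u (e g).2 * (e h).1, (e g).2 + (e h).2))
    (q : ZMod n × ZMod m) :
    (fun h => metaChar u q (e h)) ∈ irreducibleCharacters H :=
  -- Enumerating the orbit gives the space `Fin d → ℂ` that `irreducibleCharacters` asks for.
  ⟨_, metaRepresentation he q (mulOrbit u q.1).equivFin.symm,
    isIrreducible_metaRepresentation he q _,
    funext fun h => (character_metaRepresentation he q _ h).symm⟩

theorem exists_eq_metaChar
    (he : ∀ g h, e (g * h) = ((e g).1 + u (e g).2 * (e h).1, (e g).2 + (e h).2))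
    {χ : H → ℂ} (hχ : χ ∈ irreducibleCharacters H) :
    ∃ q, χ = fun h => metaChar u q (e h) := by
  let : Fintype H := Fintype.ofEquiv _ e.symm
  refine exists_eq_of_sum_eq_ite (fun q h => metaChar u q (e h))
    (fun q => (Nat.card (mulStabilizer u q.1) : ℂ)) (r := m * (n * m)) ?_
    (metaChar_mem_irreducibleCharacters he) ?_ hχ
  · simp [NeZero.ne]
  · intro h
    rw [sum_card_mulStabilizer_mul_metaChar]
    have : e h = 0 ↔ h = 1 := by
      rw [← e.injective.eq_iff (a := h), coordinates_one he]; rfl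
    simp only [this]

end Classification

/-! ### Weighted quasigroups from fibres of a map on a group. -/

section Fibers

variable {Q X : Type*} [Group Q]

theorem isQuasigroup_of_group : IsQuasigroup Q := fun a b =>
  ⟨⟨a⁻¹ * b, by simp, fun y hy => by rw [← hy]; simp⟩,
    ⟨b * a⁻¹, by simp, fun y hy => by rw [← hy]; simp⟩⟩

/-- The bijection `Φ` lets one count serve all three sum axioms: it is the identity, (p, q) ↦ (pq,
q) or (p, q) ↦ (p, pq). -/
theorem sum_card_fibers [Finite Q] [Fintype X] (f : Q → X) (Φ : Q × Q ≃ Q × Q) (g : Q × Q → X)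
    (x y : X) (P : X → Q × Q → Prop)
    (hP : ∀ z p, P z p ↔ (f (Φ p).1 = x ∧ f (Φ p).2 = y) ∧ g p = z) :
    ∑ z, Nat.card {p : Q × Q // P z p} =
      Nat.card {q : Q // f q = x} * Nat.card {q : Q // f q = y} := by
  have := Fintype.ofFinite Q
  have h1 : Nat.card {p : Q × Q // f (Φ p).1 = x ∧ f (Φ p).2 = y} =
      Nat.card {q : Q // f q = x} * Nat.card {q : Q // f q = y} := by
    rw [← Nat.card_prod]
    exact Nat.card_congr ((Φ.subtypeEquiv fun _ => Iff.rfl).trans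
      (Equiv.subtypeProdEquivProd (p := fun q => f q = x) (q := fun q => f q = y)))
  rw [← h1]
  simp only [Nat.card_eq_fintype_card, Fintype.card_subtype, hP, ← filter_filter]
  exact (card_eq_sum_card_fiberwise fun _ _ => mem_coe.2 (mem_univ _)).symm

/-- The weighted quasigroup that is covered by a map from a finite group. -/
noncomputable def fiberWeightedQuasigroup [Finite Q] [Fintype X] (f : Q → X) :
    WeightedQuasigroup X where
  w x := Nat.card {q : Q // f q = x}
  α x y z := Nat.card {p : Q × Q // f p.1 = x ∧ f p.2 = y ∧ f (p.1 * p.2) = z}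
  sum_product x y := by
    rw [← sum_card_fibers f (Equiv.refl _) (fun p => f (p.1 * p.2)) x y
      (fun z p => f p.1 = x ∧ f p.2 = y ∧ f (p.1 * p.2) = z) fun z p => and_assoc.symm]
    exact hasSum_fintype _
  sum_left x y := by
    rw [← sum_card_fibers f
      { toFun := fun p => (p.1 * p.2, p.2), invFun := fun p => (p.1 * p.2⁻¹, p.2),
        left_inv := fun p => by simp, right_inv := fun p => by simp } (fun p => f p.1) x y
      (fun z p => f p.1 = z ∧ f p.2 = y ∧ f (p.1 * p.2) = x) fun z p => by
        simp only [Equiv.coe_fn_mk]; tauto]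
    exact hasSum_fintype _
  sum_right x y := by
    rw [← sum_card_fibers f
      { toFun := fun p => (p.1, p.1 * p.2), invFun := fun p => (p.1, p.1⁻¹ * p.2),
        left_inv := fun p => by simp, right_inv := fun p => by simp } (fun p => f p.2) x y
      (fun z p => f p.1 = x ∧ f p.2 = z ∧ f (p.1 * p.2) = y) fun z p => by
        simp only [Equiv.coe_fn_mk]; tauto]
    exact hasSum_fintype _

theorem isCovering_fiberWeightedQuasigroup [Finite Q] [Fintype X] {f : Q → X}
    (hf : Function.Surjective f) : IsCovering (fiberWeightedQuasigroup f) f :=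
  ⟨inferInstance, isQuasigroup_of_group, hf, fun _ => rfl, fun _ _ _ => rfl⟩

end Fibers

/-! ### The covering and its balance. -/

section Covering

variable {n m : ℕ} [NeZero n] [NeZero m] {u : AddChar (ZMod m) (ZMod n)}

theorem sameParameters_iff (q q' : ZMod n × ZMod m) :
    SameParameters u q q' ↔ q.1 ∈ mulOrbit u q'.1 ∧ AgreeOn (mulStabilizer u q'.1) q.2 q'.2 :=
  and_congr_left fun _ => ⟨fun h => h ▸ mem_mulOrbit_self _, mulOrbit_eq_of_mem⟩

/-- The number of solutions of `x + y = d` in two orbits. -/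
theorem card_add_eq_of_mem_mulOrbit {c c' d d' : ZMod n} (h : d' ∈ mulOrbit u d) :
    Nat.card {x : ZMod n × ZMod n // x.1 ∈ mulOrbit u c ∧ x.2 ∈ mulOrbit u c' ∧ x.1 + x.2 = d} =
    Nat.card {x : ZMod n × ZMod n //
      x.1 ∈ mulOrbit u c ∧ x.2 ∈ mulOrbit u c' ∧ x.1 + x.2 = d'} := by
  obtain ⟨s, rfl⟩ := mem_mulOrbit.1 h
  let μ : ZMod n ≃ ZMod n :=
    { toFun := fun x => u s * x, invFun := fun x => u (-s) * x
      left_inv := addChar_neg_mul_cancel s, right_inv := addChar_mul_neg_cancel s }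
  refine Nat.card_congr ((Equiv.prodCongr μ μ).subtypeEquiv fun x => ?_)
  change _ ↔ u s * x.1 ∈ _ ∧ u s * x.2 ∈ _ ∧ u s * x.1 + u s * x.2 = u s * d
  rw [mul_mem_mulOrbit, mul_mem_mulOrbit, ← mul_add]
  exact and_congr_right fun _ => and_congr_right fun _ => μ.injective.eq_iff.symm

/-- Only t in `S ⊓ S'` contribute to the Fourier expression for the count, and there `l` and `l'`
define the same character. Choosing `⊤` as third subgroup turns agreement into equality. -/
theorem card_agreeOn_add_eq {S S' T : AddSubgroup (ZMod m)} (hT : S ⊓ S' ≤ T)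
    {j j' l l' : ZMod m} (h : AgreeOn T l l') :
    Nat.card {i : ZMod m × ZMod m // AgreeOn S i.1 j ∧ AgreeOn S' i.2 j' ∧ i.1 + i.2 = l} =
    Nat.card {i : ZMod m × ZMod m // AgreeOn S i.1 j ∧ AgreeOn S' i.2 j' ∧ i.1 + i.2 = l'} := by
  have h1 := card_agreeOn_add_mul_card S S' ⊤ j j' l
  have h2 := card_agreeOn_add_mul_card S S' ⊤ j j' l'
  have h3 : fourierSum (fun t => subgroupIndicator S t * subgroupIndicator S' t *
      subgroupIndicator ⊤ t) (j + j' - l) = fourierSum (fun t => subgroupIndicator S t *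
      subgroupIndicator S' t * subgroupIndicator ⊤ t) (j + j' - l') := by
    refine sum_congr rfl fun t _ => ?_
    by_cases ht : t ∈ S ∧ t ∈ S'
    · have : stdChar m (-(l * t)) = stdChar m (-(l' * t)) := by
        rw [AddChar.map_neg_eq_inv, AddChar.map_neg_eq_inv, h t (hT ht)]
      simp only [sub_eq_add_neg, AddChar.map_add_eq_mul, add_mul, neg_mul, this]
    · rcases not_and_or.1 ht with ht | ht <;> simp [subgroupIndicator, ht]
  rw [h3, ← h2] at h1
  simp only [agreeOn_top] at h1
  exact_mod_cast mul_right_cancel₀ (by simp [NeZero.ne]) h1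

variable {Q : Type*} [Group Q] {e' : Q ≃ ZMod n × ZMod m} {v : ZMod m → ZMod m}

theorem card_sameParameters (q : ZMod n × ZMod m) :
    Nat.card {p : Q // SameParameters u (e' p) q} = (mulOrbit u q.1).card ^ 2 := by
  have h1 : Nat.card {p : Q // SameParameters u (e' p) q} =
      (mulOrbit u q.1).card * Nat.card {i // AgreeOn (mulStabilizer u q.1) i q.2} := by
    rw [← Fintype.card_coe, ← Nat.card_eq_fintype_card, ← Nat.card_prod]
    exact Nat.card_congr ((e'.subtypeEquiv fun p => sameParameters_iff _ _).trans
      (Equiv.subtypeProdEquivProd (p := fun x => x ∈ mulOrbit u q.1)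
        (q := fun i => AgreeOn (mulStabilizer u q.1) i q.2)))
  have h2 := card_agreeOn_mul_card (mulStabilizer u q.1) q.2
  rw [← card_mulStabilizer_mul_card_mulOrbit (u := u) q.1, mul_comm] at h2
  have h3 := mul_left_cancel₀ (card_mulStabilizer_ne_zero q.1) h2
  rw [h1, Nat.cast_injective h3, pow_two]

/-- Pairs with prescribed parameters are counted by a product. -/
theorem card_pairs_sameParameters
    (he' : ∀ p q, e' (p * q) = ((e' p).1 + u (v (e' p).2) * (e' q).1, (e' p).2 + (e' q).2))
    (q q' : ZMod n × ZMod m) (R : ZMod n → Prop) (R' : ZMod m → Prop) :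
    Nat.card {p : Q × Q // SameParameters u (e' p.1) q ∧ SameParameters u (e' p.2) q' ∧
      R (e' (p.1 * p.2)).1 ∧ R' (e' (p.1 * p.2)).2} =
    Nat.card {x : ZMod n × ZMod n //
      x.1 ∈ mulOrbit u q.1 ∧ x.2 ∈ mulOrbit u q'.1 ∧ R (x.1 + x.2)} *
    Nat.card {i : ZMod m × ZMod m // AgreeOn (mulStabilizer u q.1) i.1 q.2 ∧
      AgreeOn (mulStabilizer u q'.1) i.2 q'.2 ∧ R' (i.1 + i.2)} := by
  -- This shear untwists the product and preserves orbits, so `v` disappears from the count.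
  let Ψ : Q × Q ≃ (ZMod n × ZMod n) × (ZMod m × ZMod m) :=
    { toFun := fun p => (((e' p.1).1, u (v (e' p.1).2) * (e' p.2).1), ((e' p.1).2, (e' p.2).2))
      invFun := fun y => (e'.symm (y.1.1, y.2.1), e'.symm (u (-v y.2.1) * y.1.2, y.2.2))
      left_inv := fun p => by simp [addChar_neg_mul_cancel]
      right_inv := fun y => by simp [addChar_mul_neg_cancel] }
  rw [← Nat.card_prod]
  refine Nat.card_congr ((Ψ.subtypeEquiv fun p => ?_).trans (Equiv.subtypeProdEquivProd
    (p := fun x : ZMod n × ZMod n => x.1 ∈ mulOrbit u q.1 ∧ x.2 ∈ mulOrbit u q'.1 ∧ R (x.1 + x.2))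
    (q := fun i : ZMod m × ZMod m => AgreeOn (mulStabilizer u q.1) i.1 q.2 ∧
      AgreeOn (mulStabilizer u q'.1) i.2 q'.2 ∧ R' (i.1 + i.2))))
  simp only [sameParameters_iff, he', Ψ, Equiv.coe_fn_mk, mul_mem_mulOrbit]
  tauto

variable {H : Type*} [Group H] {e : H ≃ ZMod n × ZMod m}

/-- A group with the multiplication `(a, s)(b, t) = (a + u (v s) b, s + t)` is a balanced cover of
the group with the multiplication `(a, s)(b, t) = (a + u s b, s + t)`. -/
theorem isBalancedCover_of_coordinates
    (he : ∀ g h, e (g * h) = ((e g).1 + u (e g).2 * (e h).1, (e g).2 + (e h).2))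
    (he' : ∀ p q, e' (p * q) = ((e' p).1 + u (v (e' p).2) * (e' q).1, (e' p).2 + (e' q).2)) :
    IsBalancedCover Q H := by
  let f : Q → irreducibleCharacters H := fun p =>
    ⟨fun h => metaChar u (e' p) (e h), metaChar_mem_irreducibleCharacters he (e' p)⟩
  have hfeq : ∀ p q, f p = f q ↔ SameParameters u (e' p) (e' q) := by
    intro p q
    rw [← metaChar_eq_iff, Subtype.ext_iff]
    exact (e.surjective.injective_comp_right (γ := ℂ)).eq_iff
      (a := metaChar u (e' p)) (b := metaChar u (e' q))
  have hf : Function.Surjective f := by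
    rintro ⟨χ, hχ⟩
    obtain ⟨q, rfl⟩ := exists_eq_metaChar he hχ
    exact ⟨e'.symm q, by simp [f]⟩
  have : Finite Q := Finite.of_equiv _ e'.symm
  have : Finite H := Finite.of_equiv _ e.symm
  let _ : Fintype H := Fintype.ofFinite H
  have : Finite (irreducibleCharacters H) := Finite.of_surjective f hf
  let _ : Fintype (irreducibleCharacters H) := Fintype.ofFinite _
  have hone : ∀ p, (f p).1 1 = (mulOrbit u (e' p).1).card := by
    intro p
    rw [← metaChar_zero, ← coordinates_one he]
  refine ⟨fiberWeightedQuasigroup f, ⟨?_, ?_⟩, f, isCovering_fiberWeightedQuasigroup hf, ?_⟩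
  · intro θ
    obtain ⟨p, rfl⟩ := hf θ
    rw [hone]
    simp only [fiberWeightedQuasigroup, hfeq]
    rw [card_sameParameters]
    push_cast
    rfl
  · intro θ φ ψ
    obtain ⟨p, rfl⟩ := hf θ
    obtain ⟨p', rfl⟩ := hf φ
    obtain ⟨p'', rfl⟩ := hf ψ
    rw [hone, hone, hone]
    have h1 := sum_metaChar_mul_metaChar_mul_conj (u := u) (e' p) (e' p') (e' p'')
    have h2 := card_agreeOn_add_mul_card (mulStabilizer u (e' p).1) (mulStabilizer u (e' p').1)
      (mulStabilizer u (e' p'').1) (e' p).2 (e' p').2 (e' p'').2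
    have h3 : charInner ((f p).1 * (f p').1) (f p'').1 = ((n : ℂ) * m)⁻¹ *
        ∑ x, metaChar u (e' p) x * metaChar u (e' p') x *
          (starRingEnd ℂ) (metaChar u (e' p'') x) := by
      rw [charInner, Nat.card_congr e, Nat.card_prod, Nat.card_zmod, Nat.card_zmod,
        finsum_eq_sum_of_fintype, ← Equiv.sum_comp e]
      push_cast
      rfl
    have h4 := card_mulStabilizer_mul_card_mulOrbit (u := u) (e' p).1
    have h5 := card_mulStabilizer_mul_card_mulOrbit (u := u) (e' p').1
    have h6 := card_mulStabilizer_mul_card_mulOrbit (u := u) (e' p'').1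
    rw [h3, h1]
    simp only [fiberWeightedQuasigroup, hfeq]
    have h7 := card_pairs_sameParameters he' (e' p) (e' p') (fun x => x ∈ mulOrbit u (e' p'').1)
      (fun i => AgreeOn (mulStabilizer u (e' p'').1) i (e' p'').2)
    simp only [← sameParameters_iff] at h7
    rw [h7]
    push_cast
    have hS := card_mulStabilizer_ne_zero (u := u) (e' p).1
    have hS' := card_mulStabilizer_ne_zero (u := u) (e' p').1
    have hS'' := card_mulStabilizer_ne_zero (u := u) (e' p'').1
    have hn : (n : ℂ) ≠ 0 := NeZero.ne _
    have hm : (m : ℂ) ≠ 0 := NeZero.ne _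
    rw [← eq_div_iff (mul_ne_zero (mul_ne_zero hS hS') hS'')] at h2
    rw [mul_comm, ← eq_div_iff hS] at h4
    rw [mul_comm, ← eq_div_iff hS'] at h5
    rw [mul_comm, ← eq_div_iff hS''] at h6
    rw [h2, h4, h5, h6]
    field_simp
  · intro x y z d d' hd hd'
    obtain ⟨p, rfl⟩ := hf x
    obtain ⟨p', rfl⟩ := hf y
    have hdd : SameParameters u (e' d') (e' d) := (hfeq _ _).1 (hd'.trans hd.symm)
    have hmult : ∀ r, fiberMultiplicity f (f p) (f p') r = _ := fun r => by
      have h := card_pairs_sameParameters he' (e' p) (e' p') (fun x => x = (e' r).1)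
        (fun i => i = (e' r).2)
      simp only [← Prod.ext_iff, EmbeddingLike.apply_eq_iff_eq, ← hfeq] at h
      exact h
    rw [hmult, hmult]
    rw [sameParameters_iff] at hdd
    rw [← card_add_eq_of_mem_mulOrbit hdd.1]
    -- Without solutions in ℤ/n both products vanish. Otherwise an element fixing both summands
    -- fixes their sum, which gives the inclusion of stabilizers.
    rcases isEmpty_or_nonempty {x : ZMod n × ZMod n // x.1 ∈ mulOrbit u (e' p).1 ∧
      x.2 ∈ mulOrbit u (e' p').1 ∧ x.1 + x.2 = (e' d).1} with h | ⟨x, hx1, hx2, hx⟩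
    · simp
    · congr 1
      refine card_agreeOn_add_eq (T := mulStabilizer u (e' d).1) ?_ (agreeOn_comm.1 hdd.2)
      rintro t ⟨ht1, ht2⟩
      rw [mem_mulStabilizer, ← hx, mul_add, (mem_mulStabilizer_iff hx1).2 ht1,
        (mem_mulStabilizer_iff hx2).2 ht2]

end Covering

/-! ### Coordinates on semidirect products of cyclic groups. -/

section Semidirect

variable {n m : ℕ} [NeZero n] [NeZero m]

theorem toAdd_mulAut_apply (φ : MulAut (Cyc n)) (x : Cyc n) :
    (φ x).toAdd = (φ (Cyc.gen n)).toAdd * x.toAdd := by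
  have hx : x = Cyc.gen n ^ x.toAdd.val := by
    apply Multiplicative.toAdd.injective
    simp
  conv_lhs => rw [hx, map_pow]
  rw [toAdd_pow, nsmul_eq_mul, ZMod.natCast_val, ZMod.cast_id, mul_comm]

/-- The multipliers by which `ℤ/m` acts on `ℤ/n`. -/
def multiplierChar (τ : Cyc m →* MulAut (Cyc n)) : AddChar (ZMod m) (ZMod n) where
  toFun t := (τ (Multiplicative.ofAdd t) (Cyc.gen n)).toAdd
  map_zero_eq_one' := by simp
  map_add_eq_mul' s t := by
    rw [ofAdd_add, map_mul, MulAut.mul_apply, toAdd_mulAut_apply]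

theorem toAdd_apply_eq_multiplierChar_mul (τ : Cyc m →* MulAut (Cyc n)) (t : Cyc m) (x : Cyc n) :
    (τ t x).toAdd = multiplierChar τ t.toAdd * x.toAdd :=
  toAdd_mulAut_apply _ _

theorem multiplierChar_of_zpow {τ σ : Cyc m →* MulAut (Cyc n)} {b : ℤ}
    (h : σ (Cyc.gen m) = τ (Cyc.gen m) ^ b) (t : ZMod m) :
    multiplierChar σ t = multiplierChar τ (b * t) := by
  have ht : Multiplicative.ofAdd t = Cyc.gen m ^ t.val := by
    apply Multiplicative.toAdd.injective
    simp
  have hbt : Multiplicative.ofAdd ((b : ZMod m) * t) = (Cyc.gen m ^ b) ^ t.val := by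
    apply Multiplicative.toAdd.injective
    simp [mul_comm]
  change (σ (Multiplicative.ofAdd t) (Cyc.gen n)).toAdd =
    (τ (Multiplicative.ofAdd ((b : ZMod m) * t)) (Cyc.gen n)).toAdd
  rw [ht, hbt, map_pow, map_pow, map_zpow, h]

/-- The coordinates of a semidirect product of two cyclic groups. -/
def semidirectCoordinates (σ : Cyc m →* MulAut (Cyc n)) : Cyc n ⋊[σ] Cyc m ≃ ZMod n × ZMod m :=
  SemidirectProduct.equivProd.trans (Equiv.prodCongr Multiplicative.toAdd Multiplicative.toAdd)

theorem semidirectCoordinates_mul (σ : Cyc m →* MulAut (Cyc n)) (p q : Cyc n ⋊[σ] Cyc m) :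
    semidirectCoordinates σ (p * q) = ((semidirectCoordinates σ p).1 +
      multiplierChar σ (semidirectCoordinates σ p).2 * (semidirectCoordinates σ q).1,
      (semidirectCoordinates σ p).2 + (semidirectCoordinates σ q).2) := by
  refine Prod.ext ?_ rfl
  change (p.left * σ p.right q.left).toAdd = _
  rw [toAdd_mul, toAdd_apply_eq_multiplierChar_mul]
  rfl

/-- Here `v` is multiplication by `b`. Allowing `H` to be an isomorphic copy avoids transporting
covers along isomorphisms. -/
theorem isBalancedCover_of_mulEquiv {H : Type*} [Group H] {τ σ : Cyc m →* MulAut (Cyc n)} {b : ℤ}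
    (h : σ (Cyc.gen m) = τ (Cyc.gen m) ^ b) (e : H ≃* Cyc n ⋊[τ] Cyc m) :
    IsBalancedCover (Cyc n ⋊[σ] Cyc m) H := by
  refine isBalancedCover_of_coordinates (u := multiplierChar τ) (v := fun t => b * t)
    (e := e.toEquiv.trans (semidirectCoordinates τ)) (e' := semidirectCoordinates σ)
    (fun g h => ?_) (fun p q => ?_)
  · simp only [Equiv.trans_apply, MulEquiv.toEquiv_eq_coe, MulEquiv.coe_toEquiv, map_mul,
      semidirectCoordinates_mul]
  · rw [semidirectCoordinates_mul, multiplierChar_of_zpow h]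

end Semidirect

theorem IsSplitMetacyclic.exists_mulEquiv {G : Type*} [Group G] [Finite G]
    (h : IsSplitMetacyclic G) : ∃ (n m : ℕ) (_ : NeZero n) (_ : NeZero m)
      (τ : Cyc m →* MulAut (Cyc n)), Nonempty (G ≃* Cyc n ⋊[τ] Cyc m) := by
  obtain ⟨N, K, hN, hNc, hKc, hNK⟩ := h
  have eN : Cyc (Nat.card N) ≃* N := zmodCyclicMulEquiv hNc
  have eK : Cyc (Nat.card K) ≃* K := zmodCyclicMulEquiv hKc
  exact ⟨Nat.card N, Nat.card K, ⟨Nat.card_pos.ne'⟩, ⟨Nat.card_pos.ne'⟩, _,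
    ⟨(SemidirectProduct.mulEquivSubgroup hNK).symm.trans
      (SemidirectProduct.congr' eN.symm eK.symm)⟩⟩

end SplitMetacyclic

theorem mainTheorem8 :
    (∀ (n m : ℕ) [NeZero n] [NeZero m] (τ σ : Cyc m →* MulAut (Cyc n)) (b : ℤ),
      σ (Cyc.gen m) = τ (Cyc.gen m) ^ b →
        IsBalancedCover (Cyc n ⋊[σ] Cyc m) (Cyc n ⋊[τ] Cyc m)) ∧
    (∀ (n m : ℕ) [NeZero n] [NeZero m] (σ : Cyc m →* MulAut (Cyc n)),
      IsBalancedCover (Cyc n ⋊[σ] Cyc m) (Cyc n ⋊[σ] Cyc m)) ∧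
    (∀ (G : Type*) [Group G] [Finite G], IsSplitMetacyclic G → HasCharacterGroup G) := by
  refine ⟨fun n m _ _ τ σ b h => isBalancedCover_of_mulEquiv h (MulEquiv.refl _),
    fun n m _ _ σ => isBalancedCover_of_mulEquiv (zpow_one _).symm (MulEquiv.refl _),
    fun G _ _ hG => ?_⟩
  -- The character group is the concrete semidirect product, which lies in `Type` whatever the
  -- universe of `G`.
  obtain ⟨n, m, _, _, τ, ⟨e⟩⟩ := hG.exists_mulEquiv
  obtain ⟨W, hW, f, hf⟩ := isBalancedCover_of_mulEquiv (σ := τ) (zpow_one _).symm e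
  exact ⟨_, inferInstance, W, hW, f, hf.toIsCovering⟩
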